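/- Let $\ell\ge 1$ and let $G=(V,E)$ be a finite directed graph whose node set is partitioned into levels $V_0=\{r\},V_1,\dots,V_\ell=X$ with $E\subseteq\bigcup_{j=1}^{\ell}V_{j-1}\times V_j$; $r$ is the root and the nodes of $X$ are the terminals. Let $K\subseteq\mathbb R^E\times\mathbb R^{X\times E}$ be the set of all $(y,f)$ satisfying $$\sum_{e\in\delta^+(v)}f_{s,e}-\sum_{e\in\delta^-(v)}f_{s,e}=\begin{cases}1&v=r\\-1&v=s\\0&\text{otherwise}\end{cases}\qquad\forall s\in X,\ v\in V,$$ $$f_{s,e}\le y_e,\qquad \sum_{e\in\delta^-(v)}y_e\le 1,\qquad 0\le y_e\le 1,\qquad 0\le f_{s,e}\le 1\qquad\forall s\in X,\ e\in E,\ v\in V.$$ For a linear system $K=\{x\in\mathbb R^n\mid Ax\ge b\}$, the $t$-th level $\mathrm{Las}_t(K)$ of the Lasserre hierarchy is the set of all vectors $(Y_I)_{I\subseteq[n],\,|I|\le 2t+2}$ with $Y_\emptyset=1$, with $(Y_{I\cup J})_{|I|,|J|\le t+1}\succeq 0$ and, for every row $a^Tx\ge\beta$ of the system, with $(Z_{I\cup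 J})_{|I|,|J|\le t}\succeq0$, where $Z_I:=\sum_i a_iY_{I\cup\{i\}}-\beta Y_I$. Let $Y\in\mathrm{Las}_{2\ell}(K)$, and for $P\subseteq E$ let $y_P$ be the entry of $Y$ at the set of capacity variables $\{y_e\mid e\in P\}$. Consider the following algorithm, which samples a random set $T$ of paths starting in $r$. Start with $T=\emptyset$. For every $e\in\delta^+(r)$, independently with probability $y_{\{e\}}$ add the path $\{e\}$ to $T$. Then for $j=1,\dots,\ell-1$, for every $u\in V_j$, every $r$-$u$ path $P\in T$ and every $e\in\delta^+(u)$, independently with probability $y_{P\cup\{e\}}/y_P$ add the path $P\cup\{e\}$ to $T$. The algorithm returns the edge set $E(T)=\bigcup_{P\in T}P$. Fix a terminal $s\in X$ and let $Z$ be the number of $r$-$s$ paths in $T$ in one run of the algorithm. Then $$E[Z]=1,\qquad E[Z\mid Z\ge 1]\le \ell+1,$$ where the event $Z\ge1$ has positive probability. Hence $\Pr[Z\ge 1]\ge\frac1{\ell+1}$; that is, with probability at least $\frac{1}{\ell+1}$ the set $E(T)$ contains an $r$-$s$ path. -/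

import Mathlib

noncomputable section

open MeasureTheory ProbabilityTheory

/-! ## The Lasserre hierarchy -/

section Lasserre

variable {ι κ : Type*} [Fintype ι] [DecidableEq ι]

/-- The matrix `M_k(y)` with rows and columns indexed by the sets of size at most `k` and
entries `y_{I ∪ J}`. -/
def momentMatrix (k : ℕ) (y : Finset ι → ℝ) :
    Matrix {I : Finset ι // I.card ≤ k} {I : Finset ι // I.card ≤ k} ℝ :=
  Matrix.of fun I J => y (I.1 ∪ J.1)

/-- For a linear constraint `∑ i, a i * x i ≥ β`, the vector `(a, β) * y` with entries
`∑ i, a i * y_{I ∪ {i}} - β * y_I`. -/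
def shiftVector (a : ι → ℝ) (β : ℝ) (y : Finset ι → ℝ) : Finset ι → ℝ :=
  fun I => ∑ i, a i * y (I ∪ {i}) - β * y I

/-- The `t`-th level `Las_t(K)` of the Lasserre hierarchy for `K = {x | A x ≥ b}`.
A member is a vector with entries `y_I`, `|I| ≤ 2t + 2`; it is written as a function on all finite
index sets, of which the conditions below inspect exactly the entries with `|I| ≤ 2t + 2` (the
other entries are arbitrary and play no role). -/
def Las (t : ℕ) (A : κ → ι → ℝ) (b : κ → ℝ) : Set (Finset ι → ℝ) :=
  {y | (momentMatrix (t + 1) y).PosSemidef ∧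
    (∀ k, (momentMatrix t (shiftVector (A k) (b k) y)).PosSemidef) ∧
    y ∅ = 1}

/-- The entries of a Lasserre solution are nonnegative and antitone in the index set. -/
theorem Las_antitone {t : ℕ} {A : κ → ι → ℝ} {b : κ → ℝ} {y : Finset ι → ℝ} (hy : y ∈ Las t A b)
    {I J : Finset ι} (hIJ : I ⊆ J) (hJ : J.card ≤ t + 1) : 0 ≤ y J ∧ y J ≤ y I := by
  have hI : I.card ≤ t + 1 := (Finset.card_le_card hIJ).trans hJ
  have hM := hy.1.submatrix ![(⟨I, hI⟩ : {I : Finset ι // I.card ≤ t + 1}), ⟨J, hJ⟩]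
  have h := hM.det_nonneg
  rw [Matrix.det_fin_two] at h
  have h1 := hM.diag_nonneg (i := 0)
  have h2 := hM.diag_nonneg (i := 1)
  simp [momentMatrix, Finset.union_eq_right.2 hIJ, Finset.union_eq_left.2 hIJ] at h h1 h2
  refine ⟨h2, ?_⟩
  rcases h2.eq_or_lt with h0 | h0
  · rw [← h0]; exact h1
  · nlinarith

end Lasserre

/-! ## Layered digraphs and the linear program -/

/-- A digraph with root `r` whose node set is partitioned into levels `V_0 = {r}, V_1, …, V_ℓ`, all
edges running from one level to the next one. -/
structure LayeredDigraph (V : Type*) (ℓ : ℕ) where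
  root : V
  level : V → ℕ
  edges : Finset (V × V)
  level_le : ∀ v, level v ≤ ℓ
  level_eq_zero_iff : ∀ v, level v = 0 ↔ v = root
  level_succ : ∀ e ∈ edges, level e.2 = level e.1 + 1

namespace LayeredDigraph

variable {V : Type*} {ℓ : ℕ} (G : LayeredDigraph V ℓ)

/-- The edge set `E`, as a type. -/
abbrev Edge : Type _ := {e : V × V // e ∈ G.edges}

/-- The terminals `X = V_ℓ` are the nodes of the last level. -/
abbrev Terminal : Type _ := {v : V // G.level v = ℓ}

/-- The variables of the linear program: a capacity `y_e` for each edge (`Sum.inl e`) and a flow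
value `f_{s,e}` for each terminal and edge (`Sum.inr (s, e)`). -/
abbrev Var : Type _ := G.Edge ⊕ (G.Terminal × G.Edge)

/-- Names of the constraints of the linear program; an equation is a pair of inequalities. -/
inductive Row
  | flowGE (s : G.Terminal) (v : V)
  | flowLE (s : G.Terminal) (v : V)
  | flowLeCap (s : G.Terminal) (e : G.Edge)
  | indegree (v : V)
  | capNonneg (e : G.Edge)
  | capLeOne (e : G.Edge)
  | flowNonneg (s : G.Terminal) (e : G.Edge)
  | flowLeOne (s : G.Terminal) (e : G.Edge)

variable [DecidableEq V]

/-- `δ⁺(v)`. -/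
def outEdges (v : V) : Finset G.Edge := Finset.univ.filter fun e => e.1.1 = v

/-- `δ⁻(v)`. -/
def inEdges (v : V) : Finset G.Edge := Finset.univ.filter fun e => e.1.2 = v

/-- The coefficient vector of the variable `y_e`. -/
def capVar (e : G.Edge) : G.Var → ℝ := Pi.single (Sum.inl e) 1

/-- The coefficient vector of the variable `f_{s,e}`. -/
def flowVar (s : G.Terminal) (e : G.Edge) : G.Var → ℝ := Pi.single (Sum.inr (s, e)) 1

/-- The coefficient vector of `∑_{e ∈ δ⁺(v)} f_{s,e} - ∑_{e ∈ δ⁻(v)} f_{s,e}`. -/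
def netOutflow (s : G.Terminal) (v : V) : G.Var → ℝ :=
  ∑ e ∈ G.outEdges v, G.flowVar s e - ∑ e ∈ G.inEdges v, G.flowVar s e

/-- The net outflow required at `v` by a unit flow from the root to `s`. -/
def demand (s : G.Terminal) (v : V) : ℝ :=
  if v = G.root then 1 else if v = s.1 then -1 else 0

/-- The rows of the constraint matrix `A` of the linear program `A x ≥ b`. -/
def lpMatrix : G.Row → G.Var → ℝ
  | .flowGE s v => G.netOutflow s v
  | .flowLE s v => -G.netOutflow s v
  | .flowLeCap s e => G.capVar e - G.flowVar s e
  | .indegree v => -∑ e ∈ G.inEdges v, G.capVar e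
  | .capNonneg e => G.capVar e
  | .capLeOne e => -G.capVar e
  | .flowNonneg s e => G.flowVar s e
  | .flowLeOne s e => -G.flowVar s e

/-- The right-hand side `b` of the linear program `A x ≥ b`. -/
def lpRhs : G.Row → ℝ
  | .flowGE s v => G.demand s v
  | .flowLE s v => -G.demand s v
  | .flowLeCap _ _ => 0
  | .indegree _ => -1
  | .capNonneg _ => 0
  | .capLeOne _ => -1
  | .flowNonneg _ _ => 0
  | .flowLeOne _ _ => -1

/-- The `t`-round Lasserre relaxation of the linear program. -/
def LasLP [Fintype V] (t : ℕ) : Set (Finset G.Var → ℝ) := Las t G.lpMatrix G.lpRhs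

/-! ## The rounding algorithm -/

/-- The list of edges `P` is a directed path from `u` to `v`. -/
def IsPath : V → List G.Edge → V → Prop
  | u, [], v => u = v
  | u, e :: P, v => e.1.1 = u ∧ IsPath e.1.2 P v

/-- `y_P := Y_{P, ∅}`, where `P` is regarded as a set of edges. -/
def pathValue (Y : Finset G.Var → ℝ) (P : List G.Edge) : ℝ := Y (P.toFinset.image Sum.inl)

/-- The ratios `y_{P ∪ {e}} / y_P` used by the algorithm below are probabilities. -/
theorem pathValue_ratio_mem [Fintype V] {t : ℕ} {Y : Finset G.Var → ℝ} (hY : Y ∈ G.LasLP t)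
    (P : List G.Edge) (e : G.Edge) (hP : P.length ≤ t) :
    0 ≤ G.pathValue Y (P ++ [e]) / G.pathValue Y P ∧
      G.pathValue Y (P ++ [e]) / G.pathValue Y P ≤ 1 := by
  have hsub : P.toFinset.image (Sum.inl : G.Edge → G.Var) ⊆ (P ++ [e]).toFinset.image Sum.inl :=
    Finset.image_subset_image (by intro x; simp +contextual)
  have hcard : ((P ++ [e]).toFinset.image (Sum.inl : G.Edge → G.Var)).card ≤ t + 1 :=
    Finset.card_image_le.trans ((List.toFinset_card_le _).trans (by simpa using hP))
  obtain ⟨h1, h2⟩ := Las_antitone hY hsub hcard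
  exact ⟨div_nonneg h1 (h1.trans h2), div_le_one_of_le₀ h2 (h1.trans h2)⟩

end LayeredDigraph

/-- A coin that shows `true` with probability `p`. It is only used for `0 ≤ p ≤ 1`, where the
truncation to `[0, 1]` does nothing. -/
def coin (p : ℝ) : PMF Bool :=
  PMF.ofFintype (fun b => cond b (min 1 (ENNReal.ofReal p)) (1 - min 1 (ENNReal.ofReal p)))
    (by simp)

namespace LayeredDigraph

variable {V : Type*} {ℓ : ℕ} (G : LayeredDigraph V ℓ) [DecidableEq V]

/-- With probability `p`, decided by a fresh coin, add the path `P` to `T`. -/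
def addWithProb (p : ℝ) (P : List G.Edge) (T : Finset (List G.Edge)) :
    PMF (Finset (List G.Edge)) :=
  (coin p).map fun b => if b then insert P T else T

/-- The first phase: for all edges `e` leaving the root, independently add the path `{e}` with
probability `y_{{e}}`. -/
def rootPhase (Y : Finset G.Var → ℝ) : PMF (Finset (List G.Edge)) :=
  (G.outEdges G.root).toList.foldlM
    (fun T e => G.addWithProb (G.pathValue Y [e]) [e] T) ∅

open Classical in
/-- The pairs `(P, e)` where `P ∈ T` is an `r`-`u` path for a node `u` in level `j`
and `e ∈ δ⁺(u)`. -/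
def extensions (T : Finset (List G.Edge)) (j : ℕ) : Finset (List G.Edge × G.Edge) :=
  (T ×ˢ Finset.univ).filter fun q => ∃ u, G.level u = j ∧ G.IsPath G.root q.1 u ∧ q.2 ∈ G.outEdges u

/-- Phase `j`: for all pairs `(P, e)` as in `extensions`, independently add the path `P ∪ {e}` with
probability `y_{P ∪ {e}} / y_P`. -/
def levelPhase (Y : Finset G.Var → ℝ) (T : Finset (List G.Edge)) (j : ℕ) :
    PMF (Finset (List G.Edge)) :=
  (G.extensions T j).toList.foldlM
    (fun S q => G.addWithProb (G.pathValue Y (q.1 ++ [q.2]) / G.pathValue Y q.1) (q.1 ++ [q.2]) S) T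

/-- One run of the rounding algorithm: the first phase, followed by the phases `1, …, ℓ - 1`. Its
outcome is the random set `T` of sampled paths. -/
def roundingPMF (Y : Finset G.Var → ℝ) : PMF (Finset (List G.Edge)) :=
  (G.rootPhase Y).bind fun T => (List.range' 1 (ℓ - 1)).foldlM (G.levelPhase Y) T

/-- The probability measure given by one run of the rounding algorithm. -/
def roundingMeasure (Y : Finset G.Var → ℝ) : Measure (Finset (List G.Edge)) :=
  (G.roundingPMF Y).toMeasure

open Classical in
/-- `Z = |T ∩ Q(s)|`, the number of sampled paths from the root to `s`. -/
def numPaths (s : V) (T : Finset (List G.Edge)) : ℕ :=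
  (T.filter fun P => G.IsPath G.root P s).card

/-- The edge set `E(T) = ⋃_{P ∈ T} P` that the algorithm returns contains a path from the root
to `s`. -/
def Connects (s : V) (T : Finset (List G.Edge)) : Prop :=
  ∃ Q : List G.Edge, G.IsPath G.root Q s ∧ ∀ e ∈ Q, ∃ P ∈ T, e ∈ P

end LayeredDigraph

end

/-!
Write `y_P` for the value of a path `P` and `𝒬` for the set of paths from the root to `s`, all of
which have exactly `ℓ` edges. The theorem is a second moment argument for `Z = ∑_{P ∈ 𝒬} [P ∈ T]`.

*The path values.* On a 0/1 solution of the linear program, exactly one path from the root to `s`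
has all capacities equal to one; the two halves of this statement survive in the hierarchy because
each of them uses the constraints only after multiplication by monomials of degree at most `2ℓ`.
Upper bound (`sum_pathsInto_le`): the constraint on the in-degree of `v`, multiplied by the monomial
of `S`, gives `∑_{e ∈ δ⁻(v)} Y_{S ∪ {e}} ≤ Y_S`, and iterating it from `s` backwards shows that the
continuations of a fixed path `R` that end in `s` have total value at most `y_R`
(`sum_pathValue_take_le`). Lower bound (`le_sum_pathsBetween`, `flowSet_le_capSet`): conservation of
the flow for `s`, multiplied by flow monomials, pushes one unit of flow forward from the root to `s`
along paths, and replacing `f_{s,e}` by `y_e` edge by edge only increases the entries. Together,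
`∑_{P ∈ 𝒬} y_P = 1` (`sum_pathValue_eq_one`).

*The algorithm.* Each phase adds the members of a list of candidates with independent coins, so the
membership events are independent given the previous phases (`sampleList_toOuterMeasure`). By
induction over the phases, `Pr[P ∈ T] = y_P` (`phasePMF_single`), whence `E[Z] = 1`. Two different
paths of equal length are extended by different coins, and the same induction gives
`Pr[P, Q ∈ T] ≤ y_P ∑_R y_Q / y_R` with `R` ranging over the common prefixes of `P` and `Q` (`phasePMF_pair`). There
are `ℓ + 1` prefixes `R` of `P`, and for each of them the sum of `y_Q / y_R` over all `Q ∈ 𝒬` with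
prefix `R` is at most one. So `E[Z²] ≤ ℓ + 1` (`sum_sum_pairBound_le`).

*Conclusion.* `E[Z] = 1` and `E[Z²] ≤ ℓ + 1` give `Pr[Z ≥ 1] ≥ 1 / (ℓ + 1)`
(`inv_le_measureReal_of_integral_sq_le`), and `E[Z | Z ≥ 1] = E[Z] / Pr[Z ≥ 1] ≤ ℓ + 1`.
-/

noncomputable section
open MeasureTheory ProbabilityTheory
open scoped ENNReal

/-! ### Lists of fixed length -/

/-- The finite set of all lists of length `k` over a finite type. -/
def listsOfLength (α : Type*) [Fintype α] (k : ℕ) : Finset (List α) :=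
  Finset.univ.map ⟨fun q : Fin k → α => List.ofFn q, List.ofFn_injective⟩

section Lists

variable {α : Type*} [Fintype α]

theorem mem_listsOfLength {k : ℕ} {l : List α} : l ∈ listsOfLength α k ↔ l.length = k := by
  constructor
  · intro h
    obtain ⟨q, -, rfl⟩ := Finset.mem_map.1 h
    simp
  · rintro rfl
    exact Finset.mem_map.2 ⟨l.get, Finset.mem_univ _, List.ofFn_get l⟩

theorem sum_listsOfLength_cons (k : ℕ) (g : List α → ℝ) :
    ∑ l ∈ listsOfLength α (k + 1), g l = ∑ a, ∑ l ∈ listsOfLength α k, g (a :: l) := by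
  simp only [listsOfLength, Finset.sum_map, Function.Embedding.coeFn_mk]
  rw [← Fintype.sum_prod_type' (f := fun a (q : Fin k → α) => g (a :: List.ofFn q))]
  refine (Fintype.sum_equiv (Fin.consEquiv fun _ => α) _ _ fun x => ?_).symm
  simp [Fin.consEquiv, List.ofFn_succ]

theorem sum_listsOfLength_snoc (k : ℕ) (g : List α → ℝ) :
    ∑ l ∈ listsOfLength α (k + 1), g l = ∑ a, ∑ l ∈ listsOfLength α k, g (l ++ [a]) := by
  simp only [listsOfLength, Finset.sum_map, Function.Embedding.coeFn_mk]
  rw [← Fintype.sum_prod_type' (f := fun a (q : Fin k → α) => g (List.ofFn q ++ [a]))]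
  refine (Fintype.sum_equiv (Fin.snocEquiv fun _ => α) _ _ fun x => ?_).symm
  simp only [Fin.snocEquiv, List.ofFn_succ', Equiv.coe_fn_mk, List.concat_eq_append]
  simp

end Lists

/-! ### Paths in a layered digraph -/

namespace LayeredDigraph

variable {V : Type*} {ℓ : ℕ} {G : LayeredDigraph V ℓ}

theorem isPath_append_singleton {u v : V} {P : List G.Edge} {e : G.Edge} :
    G.IsPath u (P ++ [e]) v ↔ G.IsPath u P e.1.1 ∧ e.1.2 = v := by
  induction P generalizing u with
  | nil => simp [IsPath, eq_comm]
  | cons a P ih => simp [IsPath, ih, and_assoc]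

theorem isPath_append {u v : V} {P Q : List G.Edge} :
    G.IsPath u (P ++ Q) v ↔ ∃ w, G.IsPath u P w ∧ G.IsPath w Q v := by
  induction P generalizing u with
  | nil => simp [IsPath]
  | cons a P ih => simp [IsPath, ih, and_assoc]

theorem IsPath.level_eq {u v : V} {P : List G.Edge} (h : G.IsPath u P v) :
    G.level v = G.level u + P.length := by
  induction P generalizing u with
  | nil => cases h; simp
  | cons a P ih =>
    have h1 := ih h.2
    have h2 := G.level_succ a.1 a.2
    rw [h.1] at h2
    simp only [List.length_cons]
    omega

theorem level_root : G.level G.root = 0 := (G.level_eq_zero_iff _).2 rfl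

variable (G)

open Classical in
/-- The paths with `k` edges from `u` to `v`. -/
def pathsBetween (k : ℕ) (u v : V) : Finset (List G.Edge) :=
  (listsOfLength G.Edge k).filter fun P => G.IsPath u P v

open Classical in
/-- The paths with `k` edges that end in `v`. -/
def pathsInto (k : ℕ) (v : V) : Finset (List G.Edge) :=
  (listsOfLength G.Edge k).filter fun P => ∃ u, G.IsPath u P v

variable {G}

theorem mem_pathsBetween {k : ℕ} {u v : V} {P : List G.Edge} :
    P ∈ G.pathsBetween k u v ↔ P.length = k ∧ G.IsPath u P v := by
  simp [pathsBetween, mem_listsOfLength]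

theorem mem_pathsInto {k : ℕ} {v : V} {P : List G.Edge} :
    P ∈ G.pathsInto k v ↔ P.length = k ∧ ∃ u, G.IsPath u P v := by
  simp [pathsInto, mem_listsOfLength]

variable [DecidableEq V]

theorem sum_pathsInto_succ (k : ℕ) (v : V) (g : List G.Edge → ℝ) :
    ∑ P ∈ G.pathsInto (k + 1) v, g P =
      ∑ e ∈ G.inEdges v, ∑ P ∈ G.pathsInto k e.1.1, g (P ++ [e]) := by
  classical
  simp only [pathsInto, inEdges, Finset.sum_filter, sum_listsOfLength_snoc]
  refine Finset.sum_congr rfl fun e _ => ?_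
  by_cases he : e.1.2 = v <;> simp [isPath_append_singleton, he]

theorem sum_pathsBetween_succ (k : ℕ) (u v : V) (g : List G.Edge → ℝ) :
    ∑ P ∈ G.pathsBetween (k + 1) u v, g P =
      ∑ e ∈ G.outEdges u, ∑ P ∈ G.pathsBetween k e.1.2 v, g (e :: P) := by
  classical
  simp only [pathsBetween, outEdges, Finset.sum_filter, sum_listsOfLength_cons]
  refine Finset.sum_congr rfl fun e _ => ?_
  by_cases he : e.1.1 = u <;> simp [IsPath, he]

/-- The variables `y_e`, `e ∈ P`. -/
def capSet (P : List G.Edge) : Finset G.Var := P.toFinset.image Sum.inl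

/-- The variables `f_{s,e}`, `e ∈ P`. -/
def flowSet (s : G.Terminal) (P : List G.Edge) : Finset G.Var :=
  P.toFinset.image fun e => Sum.inr (s, e)

theorem pathValue_eq (Y : Finset G.Var → ℝ) (P : List G.Edge) :
    G.pathValue Y P = Y (capSet P) := rfl

theorem card_capSet_le (P : List G.Edge) : (capSet P).card ≤ P.length :=
  Finset.card_image_le.trans (List.toFinset_card_le _)

theorem card_flowSet_le (s : G.Terminal) (P : List G.Edge) : (flowSet s P).card ≤ P.length :=
  Finset.card_image_le.trans (List.toFinset_card_le _)

theorem capSet_append (P Q : List G.Edge) : capSet (P ++ Q) = capSet P ∪ capSet Q := by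
  simp [capSet, Finset.image_union]

theorem capSet_cons (e : G.Edge) (P : List G.Edge) :
    capSet (e :: P) = {Sum.inl e} ∪ capSet P := by
  rw [capSet, List.toFinset_cons, Finset.image_insert, Finset.insert_eq]; rfl

theorem flowSet_cons (s : G.Terminal) (e : G.Edge) (P : List G.Edge) :
    flowSet s (e :: P) = {Sum.inr (s, e)} ∪ flowSet s P := by
  rw [flowSet, List.toFinset_cons, Finset.image_insert, Finset.insert_eq]; rfl

end LayeredDigraph

/-! ### Constraints of the linear program, multiplied by a monomial -/

section Lasserre

variable {ι κ : Type*} [Fintype ι] [DecidableEq ι]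

/-- The diagonal entries of the localizing matrices: a constraint may be multiplied by the monomial
of a set of size at most `t`. -/
theorem Las_shiftVector_nonneg {t : ℕ} {A : κ → ι → ℝ} {b : κ → ℝ} {y : Finset ι → ℝ}
    (hy : y ∈ Las t A b) (k : κ) {S : Finset ι} (hS : S.card ≤ t) :
    0 ≤ shiftVector (A k) (b k) y S := by
  have h := (hy.2.1 k).diag_nonneg (i := ⟨S, hS⟩)
  simpa [momentMatrix] using h

theorem sum_sum_single_mul {β : Type*} (s : Finset β) (h : β → ι) (g : ι → ℝ) :
    ∑ i, (∑ e ∈ s, (Pi.single (h e) 1 : ι → ℝ)) i * g i = ∑ e ∈ s, g (h e) := by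
  simp only [Finset.sum_apply, Finset.sum_mul]
  rw [Finset.sum_comm]
  simp [Pi.single_apply]

end Lasserre

namespace LayeredDigraph

variable {V : Type*} [Fintype V] [DecidableEq V] {ℓ : ℕ} {G : LayeredDigraph V ℓ} {t : ℕ}
  {Y : Finset G.Var → ℝ}

theorem sum_inEdges_le (hY : Y ∈ G.LasLP t) (v : V) {S : Finset G.Var} (hS : S.card ≤ t) :
    ∑ e ∈ G.inEdges v, Y (S ∪ {Sum.inl e}) ≤ Y S := by
  have h := Las_shiftVector_nonneg hY (.indegree v) hS
  have h2 := sum_sum_single_mul (G.inEdges v) (fun e => (Sum.inl e : G.Var)) (fun i => Y (S ∪ {i}))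
  simp only [shiftVector, lpMatrix, lpRhs, capVar, Pi.neg_apply, neg_mul,
    Finset.sum_neg_distrib] at h
  rw [h2] at h
  linarith

theorem flow_le_cap (hY : Y ∈ G.LasLP t) (s : G.Terminal) (e : G.Edge) {S : Finset G.Var}
    (hS : S.card ≤ t) : Y (S ∪ {Sum.inr (s, e)}) ≤ Y (S ∪ {Sum.inl e}) := by
  have h := Las_shiftVector_nonneg hY (.flowLeCap s e) hS
  simp [shiftVector, lpMatrix, lpRhs, capVar, flowVar, sub_mul, Pi.single_apply] at h
  simpa using h

/-- Multiplying an equation by a monomial gives an equation: the diagonal entries of both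
localizing matrices, for `≥` and for `≤`, are nonnegative. -/
theorem flow_conservation (hY : Y ∈ G.LasLP t) (s : G.Terminal) (v : V) {S : Finset G.Var}
    (hS : S.card ≤ t) :
    ∑ e ∈ G.outEdges v, Y (S ∪ {Sum.inr (s, e)}) - ∑ e ∈ G.inEdges v, Y (S ∪ {Sum.inr (s, e)}) =
      G.demand s v * Y S := by
  have h1 := Las_shiftVector_nonneg hY (.flowGE s v) hS
  have h2 := Las_shiftVector_nonneg hY (.flowLE s v) hS
  have h3 := sum_sum_single_mul (G.outEdges v) (fun e => (Sum.inr (s, e) : G.Var))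
    (fun i => Y (S ∪ {i}))
  have h4 := sum_sum_single_mul (G.inEdges v) (fun e => (Sum.inr (s, e) : G.Var))
    (fun i => Y (S ∪ {i}))
  simp only [shiftVector, lpMatrix, lpRhs, netOutflow, flowVar, Pi.neg_apply, Pi.sub_apply,
    neg_mul, sub_mul, Finset.sum_neg_distrib, Finset.sum_sub_distrib] at h1 h2
  rw [h3, h4] at h1 h2
  linarith

/-! ### The path values form a unit flow -/

/-- Since every in-degree is at most one, summing over the last edge, then the edge before it, and
so on, never increases the value. -/
theorem sum_pathsInto_le (hY : Y ∈ G.LasLP t) (k : ℕ) (v : V) (S : Finset G.Var)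
    (hS : S.card + k ≤ t + 1) : ∑ P ∈ G.pathsInto k v, Y (S ∪ capSet P) ≤ Y S := by
  induction k generalizing v S with
  | zero =>
    have h : G.pathsInto 0 v = {[]} := by
      ext P
      simp only [mem_pathsInto, Finset.mem_singleton, List.length_eq_zero_iff]
      refine ⟨fun h => h.1, ?_⟩
      rintro rfl
      exact ⟨rfl, v, rfl⟩
    simp [h, capSet]
  | succ k ih =>
    rw [sum_pathsInto_succ]
    refine le_trans (Finset.sum_le_sum fun e _ => ?_) (sum_inEdges_le hY v (by omega))
    refine le_trans (le_of_eq ?_) (ih e.1.1 (S ∪ {Sum.inl e}) ?_)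
    · refine Finset.sum_congr rfl fun P _ => ?_
      rw [capSet_append, Finset.union_assoc, Finset.union_comm (capSet P)]
      simp [capSet]
    · have := Finset.card_union_le S {Sum.inl e}
      rw [Finset.card_singleton] at this
      omega

/-- Flow that has arrived in `v` leaves `v` again, and in the last level it can only be at `s`:
the flow monomials of the paths from `v` to `s`, multiplied by the monomial of `S`, sum up to at
least `Y S`. The last hypothesis says that `v` is reached on `S`: it is the root, or `S` contains
the flow variable of an edge into `v`. -/
theorem le_sum_pathsBetween (hY : Y ∈ G.LasLP t) (s : G.Terminal) (k : ℕ) (v : V)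
    (hv : G.level v + k = ℓ) (S : Finset G.Var) (hS : S.card + k ≤ t)
    (hroot : v = G.root ∧ 1 ≤ k ∨ ∃ e ∈ G.inEdges v, Sum.inr (s, e) ∈ S) :
    Y S ≤ ∑ P ∈ G.pathsBetween k v s.1, Y (S ∪ flowSet s P) := by
  have nonneg : ∀ I : Finset G.Var, I.card ≤ t + 1 → 0 ≤ Y I := fun I hI =>
    (Las_antitone hY (Finset.Subset.refl I) hI).1
  -- an edge of `S` into `v` alone contributes `Y S` to the flow arriving in `v`
  have incoming : ∀ (v : V) (S : Finset G.Var), S.card ≤ t → ∀ e ∈ G.inEdges v,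
      Sum.inr (s, e) ∈ S → Y S ≤ ∑ e ∈ G.inEdges v, Y (S ∪ {Sum.inr (s, e)}) := by
    intro v S hS e he heS
    refine le_trans (le_of_eq ?_) (Finset.single_le_sum (fun e' _ => nonneg _ ?_) he)
    · rw [Finset.union_eq_left.2 (Finset.singleton_subset_iff.2 heS)]
    · refine (Finset.card_union_le _ _).trans ?_
      rw [Finset.card_singleton]; omega
  induction k generalizing v S with
  | zero =>
    have hflow := flow_conservation hY s v (S := S) (by omega)
    obtain ⟨-, h⟩ | ⟨e, he, heS⟩ := hroot
    · omega
    have hout : G.outEdges v = ∅ := by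
      refine Finset.filter_eq_empty_iff.2 fun e _ h => ?_
      have h1 := G.level_succ e.1 e.2
      have h2 := G.level_le e.1.2
      rw [h] at h1
      omega
    by_cases hvs : v = s.1
    · have h : G.pathsBetween 0 v s.1 = {[]} := by
        ext P
        simp only [mem_pathsBetween, Finset.mem_singleton, List.length_eq_zero_iff]
        refine ⟨fun h => h.1, ?_⟩
        rintro rfl
        exact ⟨rfl, hvs⟩
      simp [h, flowSet]
    · have h : G.pathsBetween 0 v s.1 = ∅ := by
        refine Finset.eq_empty_of_forall_notMem fun P hP => ?_
        obtain ⟨h1, h2⟩ := mem_pathsBetween.1 hP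
        rw [List.length_eq_zero_iff] at h1
        subst h1
        exact hvs h2
      have hvr : v ≠ G.root := by
        rintro rfl
        have h1 := G.level_succ e.1 e.2
        rw [(Finset.mem_filter.1 he).2, level_root] at h1
        omega
      have h1 := incoming v S (by omega) e he heS
      rw [hout, Finset.sum_empty, demand, if_neg hvr, if_neg hvs] at hflow
      rw [h, Finset.sum_empty]
      linarith
  | succ k ih =>
    have hflow := flow_conservation hY s v (S := S) (by omega)
    rw [sum_pathsBetween_succ]
    have hvs : v ≠ s.1 := by
      rintro rfl
      have := s.2
      omega
    have hout : Y S ≤ ∑ e ∈ G.outEdges v, Y (S ∪ {Sum.inr (s, e)}) := by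
      by_cases hvr : v = G.root
      · have hin : G.inEdges v = ∅ := by
          refine Finset.filter_eq_empty_iff.2 fun e _ h => ?_
          have h1 := G.level_succ e.1 e.2
          rw [h, hvr, level_root] at h1
          omega
        rw [hin, Finset.sum_empty, demand, if_pos hvr] at hflow
        linarith
      · obtain ⟨h, -⟩ | ⟨e, he, heS⟩ := hroot
        · exact absurd h hvr
        have h1 := incoming v S (by omega) e he heS
        rw [demand, if_neg hvr, if_neg hvs] at hflow
        linarith
    refine hout.trans (Finset.sum_le_sum fun e he => ?_)
    have hcard := Finset.card_union_le S {Sum.inr (s, e)}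
    rw [Finset.card_singleton] at hcard
    have hmem : ∃ e' ∈ G.inEdges e.1.2, Sum.inr (s, e') ∈ S ∪ {Sum.inr (s, e)} :=
      ⟨e, by simp [inEdges], by simp⟩
    refine le_trans (ih e.1.2 ?_ (S ∪ {Sum.inr (s, e)}) (by omega) (Or.inr hmem))
      (le_of_eq ?_)
    · have h1 := G.level_succ e.1 e.2
      rw [(Finset.mem_filter.1 he).2] at h1
      omega
    · exact Finset.sum_congr rfl fun P _ => by rw [flowSet_cons, Finset.union_assoc]

/-- Replacing flow variables by the capacities that bound them, one edge at a time, does not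
decrease an entry. -/
theorem flowSet_le_capSet (hY : Y ∈ G.LasLP t) (s : G.Terminal) (P : List G.Edge)
    (S : Finset G.Var) (hS : S.card + P.length ≤ t + 1) :
    Y (S ∪ flowSet s P) ≤ Y (S ∪ capSet P) := by
  induction P generalizing S with
  | nil => simp [flowSet, capSet]
  | cons e P ih =>
    rw [List.length_cons] at hS
    have hcard := Finset.card_union_le S {Sum.inl e}
    rw [Finset.card_singleton] at hcard
    have hcard' := Finset.card_union_le S (flowSet s P)
    have h1 := card_flowSet_le s P
    calc Y (S ∪ flowSet s (e :: P)) = Y (S ∪ flowSet s P ∪ {Sum.inr (s, e)}) := by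
          rw [flowSet_cons, Finset.union_comm {Sum.inr (s, e)}, Finset.union_assoc]
      _ ≤ Y (S ∪ flowSet s P ∪ {Sum.inl e}) := flow_le_cap hY s e (by omega)
      _ = Y (S ∪ {Sum.inl e} ∪ flowSet s P) := by rw [Finset.union_right_comm]
      _ ≤ Y (S ∪ {Sum.inl e} ∪ capSet P) := ih _ (by omega)
      _ = Y (S ∪ capSet (e :: P)) := by rw [capSet_cons, Finset.union_assoc]

theorem pathValue_nonneg (hY : Y ∈ G.LasLP t) {P : List G.Edge} (hP : P.length ≤ t + 1) :
    0 ≤ G.pathValue Y P :=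
  (Las_antitone hY (Finset.Subset.refl _) ((card_capSet_le P).trans hP)).1

theorem pathValue_nil (hY : Y ∈ G.LasLP t) : G.pathValue Y [] = 1 := by
  simpa [pathValue] using hY.2.2

/-- Conditioned on a prefix of length `i`, at most one continuation leads to `s`. -/
theorem sum_pathValue_take_le (hY : Y ∈ G.LasLP t) (u v : V) {k i : ℕ} (hk : k ≤ t + 1)
    (hi : i ≤ k) {R : List G.Edge} (hR : R.length = i) :
    ∑ P ∈ (G.pathsBetween k u v).filter (fun P => P.take i = R), G.pathValue Y P ≤
      G.pathValue Y R := by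
  have hR' := card_capSet_le R
  refine le_trans ?_ (sum_pathsInto_le hY (k - i) v (capSet R) (by omega))
  have hdrop : ∀ P ∈ (G.pathsBetween k u v).filter (fun P => P.take i = R),
      P = R ++ P.drop i := by
    intro P hP
    rw [← (Finset.mem_filter.1 hP).2, List.take_append_drop]
  have hinj : Set.InjOn (List.drop i)
      ((G.pathsBetween k u v).filter (fun P => P.take i = R) : Set (List G.Edge)) := by
    intro P hP Q hQ h
    rw [hdrop P hP, hdrop Q hQ, h]
  calc ∑ P ∈ (G.pathsBetween k u v).filter (fun P => P.take i = R), G.pathValue Y P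
      = ∑ P ∈ (G.pathsBetween k u v).filter (fun P => P.take i = R),
          Y (capSet R ∪ capSet (P.drop i)) := by
        refine Finset.sum_congr rfl fun P hP => ?_
        rw [← capSet_append, ← hdrop P hP, pathValue_eq]
    _ = ∑ Q ∈ ((G.pathsBetween k u v).filter (fun P => P.take i = R)).image (List.drop i),
          Y (capSet R ∪ capSet Q) :=
        (Finset.sum_image (f := fun Q => Y (capSet R ∪ capSet Q)) hinj).symm
    _ ≤ ∑ Q ∈ G.pathsInto (k - i) v, Y (capSet R ∪ capSet Q) := by
        refine Finset.sum_le_sum_of_subset_of_nonneg ?_ ?_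
        · intro Q hQ
          obtain ⟨P, hP, rfl⟩ := Finset.mem_image.1 hQ
          have hPR := hdrop P hP
          obtain ⟨hlen, hpath⟩ := mem_pathsBetween.1 (Finset.mem_filter.1 hP).1
          rw [hPR, isPath_append] at hpath
          obtain ⟨w, -, hw⟩ := hpath
          exact mem_pathsInto.2 ⟨by rw [List.length_drop, hlen], w, hw⟩
        · intro Q hQ _
          rw [← capSet_append]
          have := (mem_pathsInto.1 hQ).1
          exact pathValue_nonneg hY (by rw [List.length_append]; omega)

/-- The path values of all paths from the root to a terminal sum up to one. -/
theorem sum_pathValue_eq_one (hℓ : 1 ≤ ℓ) (hY : Y ∈ G.LasLP t) (ht : ℓ ≤ t) (s : V)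
    (hs : G.level s = ℓ) : ∑ P ∈ G.pathsBetween ℓ G.root s, G.pathValue Y P = 1 := by
  refine le_antisymm ?_ ?_
  · have h := sum_pathValue_take_le hY G.root s (k := ℓ) (i := 0) (by omega) (Nat.zero_le _)
      (R := []) rfl
    simpa [pathValue_nil hY] using h
  · have h := le_sum_pathsBetween hY ⟨s, hs⟩ ℓ G.root (by rw [level_root]; omega) ∅ (by simpa)
      (Or.inl ⟨rfl, hℓ⟩)
    rw [hY.2.2] at h
    refine h.trans (Finset.sum_le_sum fun P hP => ?_)
    have hlen := (mem_pathsBetween.1 hP).1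
    have := flowSet_le_capSet hY ⟨s, hs⟩ P ∅ (by rw [Finset.card_empty]; omega)
    simpa [pathValue_eq] using this

end LayeredDigraph

/-! ### Adding paths with independent coins -/

theorem coin_bind_toOuterMeasure {β : Type*} (p : ℝ) (f : Bool → PMF β) (A : Set β) :
    ((coin p).bind f).toOuterMeasure A =
      min 1 (ENNReal.ofReal p) * (f true).toOuterMeasure A +
        (1 - min 1 (ENNReal.ofReal p)) * (f false).toOuterMeasure A := by
  rw [PMF.toOuterMeasure_bind_apply, tsum_fintype, Fintype.sum_bool]
  rfl

namespace LayeredDigraph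

section Sampling

variable {V : Type*} {ℓ : ℕ} {G : LayeredDigraph V ℓ} [DecidableEq V]

/-- For every path `R` of the list `L`, independently add `R` to `T` with probability `ρ R`. -/
def sampleList (ρ : List G.Edge → ℝ) (L : List (List G.Edge)) (T : Finset (List G.Edge)) :
    PMF (Finset (List G.Edge)) :=
  L.foldlM (fun S R => G.addWithProb (ρ R) R S) T

theorem sampleList_cons (ρ : List G.Edge → ℝ) (R : List G.Edge) (L : List (List G.Edge))
    (T : Finset (List G.Edge)) :
    sampleList ρ (R :: L) T =
      (coin (ρ R)).bind fun b => sampleList ρ L (if b then insert R T else T) := by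
  change (PMF.map _ (coin (ρ R))).bind _ = _
  rw [PMF.bind_map]
  rfl

/-- The events that `R` is a member of the sampled set are independent over all paths `R`. -/
theorem sampleList_toOuterMeasure (ρ : List G.Edge → ℝ) (B : Finset (List G.Edge))
    (L : List (List G.Edge)) (hL : L.Nodup) (T : Finset (List G.Edge)) :
    (sampleList ρ L T).toOuterMeasure {S | B ⊆ S} =
      ∏ R ∈ B, if R ∈ T then 1 else if R ∈ L then min 1 (ENNReal.ofReal (ρ R)) else 0 := by
  induction L generalizing T with
  | nil =>
    change (PMF.pure T).toOuterMeasure _ = _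
    rw [PMF.toOuterMeasure_pure_apply]
    simp only [List.not_mem_nil, if_false, Set.mem_ofPred_eq]
    by_cases h : B ⊆ T
    · rw [if_pos h, Finset.prod_eq_one fun R hR => if_pos (h hR)]
    · obtain ⟨R, hR, hRT⟩ := Finset.not_subset.1 h
      rw [if_neg h, Finset.prod_eq_zero hR (if_neg hRT)]
  | cons C L ih =>
    obtain ⟨hC, hL⟩ := List.nodup_cons.1 hL
    have hsum : min 1 (ENNReal.ofReal (ρ C)) + (1 - min 1 (ENNReal.ofReal (ρ C))) = 1 :=
      add_tsub_cancel_of_le (min_le_left _ _)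
    rw [sampleList_cons, coin_bind_toOuterMeasure, ih hL, ih hL]
    simp only [if_true, Bool.false_eq_true, if_false]
    -- the coin of `C` matters only if `C` belongs to `B` and not yet to `T`
    by_cases hCB : C ∈ B ∧ C ∉ T
    · obtain ⟨hCB, hCT⟩ := hCB
      rw [Finset.prod_eq_zero (s := B) (i := C)
        (f := fun R => if R ∈ T then (1 : ℝ≥0∞) else
          if R ∈ L then min 1 (ENNReal.ofReal (ρ R)) else 0) hCB (by simp [hCT, hC])]
      rw [mul_zero, add_zero, ← Finset.mul_prod_erase _ _ hCB, ← Finset.mul_prod_erase _ _ hCB]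
      simp only [Finset.mem_insert_self, if_true, one_mul, hCT, if_false, List.mem_cons_self]
      congr 1
      refine Finset.prod_congr rfl fun R hR => ?_
      have hne := (Finset.mem_erase.1 hR).1
      simp [hne]
    · have hne : ∀ R ∈ B, R = C → R ∈ T := fun R hR h => by
        subst h
        by_contra hT
        exact hCB ⟨hR, hT⟩
      rw [← Finset.prod_congr rfl fun R hR => ?_, ← Finset.prod_congr rfl fun R hR => ?_,
        ← add_mul, hsum, one_mul]
      · by_cases h : R ∈ T
        · simp [h]
        · have : R ≠ C := fun h' => h (hne R hR h')
          simp [h, this]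
      · by_cases h : R ∈ T
        · simp [h]
        · have : R ≠ C := fun h' => h (hne R hR h')
          simp [h, this]

theorem sampleList_support (ρ : List G.Edge → ℝ) (L : List (List G.Edge)) (hL : L.Nodup)
    (T S : Finset (List G.Edge)) (hS : S ∈ (sampleList ρ L T).support) {R : List G.Edge}
    (hR : R ∈ S) : R ∈ T ∨ R ∈ L := by
  by_contra! h
  have h0 := sampleList_toOuterMeasure ρ {R} L hL T
  rw [Finset.prod_singleton, if_neg h.1, if_neg h.2, PMF.toOuterMeasure_apply_eq_zero_iff] at h0
  exact Set.disjoint_left.1 h0 hS (Finset.singleton_subset_iff.2 hR)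

end Sampling

/-! ### The phases of the algorithm -/

section Phases

variable {V : Type*} {ℓ : ℕ} {G : LayeredDigraph V ℓ} [DecidableEq V]

/-- The probability with which the algorithm adds the path `R` once `R` without its last edge is
present. -/
def stepProb (Y : Finset G.Var → ℝ) (R : List G.Edge) : ℝ :=
  G.pathValue Y R / G.pathValue Y R.dropLast

/-- The paths that may be added in phase `j`. -/
def candidates (T : Finset (List G.Edge)) (j : ℕ) : List (List G.Edge) :=
  (G.extensions T j).toList.map fun q => q.1 ++ [q.2]

theorem nodup_candidates (T : Finset (List G.Edge)) (j : ℕ) : (candidates T j).Nodup := by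
  refine (Finset.nodup_toList _).map fun q q' h => ?_
  obtain ⟨h1, h2⟩ := List.append_inj' h rfl
  exact Prod.ext h1 (List.singleton_inj.1 h2)

theorem mem_candidates {T : Finset (List G.Edge)} {j : ℕ} {P : List G.Edge} {e : G.Edge} :
    P ++ [e] ∈ candidates T j ↔ P ∈ T ∧ G.level e.1.1 = j ∧ G.IsPath G.root P e.1.1 := by
  classical
  rw [candidates, List.mem_map]
  constructor
  · rintro ⟨⟨P', e'⟩, hq, h⟩
    obtain ⟨rfl, h2⟩ := List.append_inj' h rfl
    obtain rfl := List.singleton_inj.1 h2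
    rw [Finset.mem_toList] at hq
    obtain ⟨hT, u, hu, hp, he⟩ := Finset.mem_filter.1 hq
    obtain rfl := (Finset.mem_filter.1 he).2
    exact ⟨(Finset.mem_product.1 hT).1, hu, hp⟩
  · rintro ⟨hT, hl, hp⟩
    refine ⟨(P, e), ?_, rfl⟩
    rw [Finset.mem_toList]
    exact Finset.mem_filter.2 ⟨Finset.mem_product.2 ⟨hT, Finset.mem_univ _⟩, _, hl, hp,
      Finset.mem_filter.2 ⟨Finset.mem_univ _, rfl⟩⟩

theorem length_of_mem_candidates {T : Finset (List G.Edge)} {j : ℕ} {R : List G.Edge}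
    (h : R ∈ candidates T j) : R.length = j + 1 := by
  obtain ⟨q, -, rfl⟩ := List.mem_map.1 h
  obtain ⟨-, hl, hp⟩ := mem_candidates.1 h
  have := hp.level_eq
  rw [level_root, hl] at this
  rw [List.length_append, List.length_singleton]
  omega

theorem levelPhase_eq (Y : Finset G.Var → ℝ) (T : Finset (List G.Edge)) (j : ℕ) :
    G.levelPhase Y T j = sampleList (stepProb Y) (candidates T j) T := by
  rw [sampleList, candidates, List.foldlM_map]
  simp only [stepProb, List.dropLast_concat]
  rfl

/-- The first phase extends the empty path, which has value one although it is never stored. -/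
theorem rootPhase_eq {Y : Finset G.Var → ℝ} (h0 : Y ∅ = 1) :
    G.rootPhase Y = sampleList (stepProb Y) ((G.outEdges G.root).toList.map fun e => [e]) ∅ := by
  have h : G.pathValue Y [] = 1 := by simpa [pathValue] using h0
  rw [sampleList, List.foldlM_map]
  simp only [stepProb, List.dropLast_singleton, h, div_one]
  rfl

theorem nodup_rootCandidates : ((G.outEdges G.root).toList.map fun e => [e]).Nodup :=
  (Finset.nodup_toList _).map fun _ _ h => List.singleton_inj.1 h

/-- The random set of paths after the first phase and `n` further phases. -/
def phasePMF (Y : Finset G.Var → ℝ) : ℕ → PMF (Finset (List G.Edge))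
  | 0 => G.rootPhase Y
  | n + 1 => (phasePMF Y n).bind fun T => G.levelPhase Y T (n + 1)

theorem roundingPMF_eq (Y : Finset G.Var → ℝ) : G.roundingPMF Y = phasePMF Y (ℓ - 1) := by
  suffices h : ∀ n, ((G.rootPhase Y).bind fun T => (List.range' 1 n).foldlM (G.levelPhase Y) T) =
      phasePMF Y n from h _
  intro n
  induction n with
  | zero => exact PMF.bind_pure _
  | succ n ih =>
    rw [phasePMF, ← ih, PMF.bind_bind]
    congr 1
    funext T
    rw [List.range'_concat, List.foldlM_append, one_mul, add_comm 1 n]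
    change PMF.bind _ _ = _
    congr 1
    funext S
    exact PMF.bind_pure _

theorem phasePMF_length_le {Y : Finset G.Var → ℝ} (h0 : Y ∅ = 1) (n : ℕ)
    {T : Finset (List G.Edge)} (hT : T ∈ (phasePMF Y n).support) {R : List G.Edge} (hR : R ∈ T) :
    R.length ≤ n + 1 := by
  induction n generalizing T with
  | zero =>
    rw [phasePMF, rootPhase_eq h0] at hT
    rcases sampleList_support _ _ nodup_rootCandidates _ _ hT hR with h | h
    · exact absurd h (Finset.notMem_empty _)
    · obtain ⟨e, -, rfl⟩ := List.mem_map.1 h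
      simp
  | succ n ih =>
    rw [phasePMF, PMF.mem_support_bind_iff] at hT
    obtain ⟨T', hT', hT⟩ := hT
    rw [levelPhase_eq] at hT
    rcases sampleList_support _ _ (nodup_candidates _ _) _ _ hT hR with h | h
    · exact (ih hT' h).trans (Nat.le_succ _)
    · exact (length_of_mem_candidates h).le

theorem append_notMem_of_mem_support {Y : Finset G.Var → ℝ} (h0 : Y ∅ = 1) {n : ℕ}
    {T : Finset (List G.Edge)} (hT : T ∈ (phasePMF Y n).support) {P : List G.Edge} {e : G.Edge}
    (hlen : P.length = n + 1) : P ++ [e] ∉ T := fun h => by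
  have := phasePMF_length_le h0 n hT h
  rw [List.length_append, List.length_singleton] at this
  omega

theorem mem_candidates_iff {T : Finset (List G.Edge)} {j : ℕ} {P : List G.Edge} {e : G.Edge}
    (hP : G.IsPath G.root P e.1.1) (hlen : P.length = j) :
    P ++ [e] ∈ candidates T j ↔ P ∈ T := by
  have h := hP.level_eq
  rw [level_root, zero_add, hlen] at h
  rw [mem_candidates, and_iff_left ⟨h, hP⟩]

theorem sampleList_single (ρ : List G.Edge → ℝ) {L : List (List G.Edge)} (hL : L.Nodup)
    {T : Finset (List G.Edge)} {P : List G.Edge} (hP : P ∉ T) :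
    (sampleList ρ L T).toOuterMeasure {S | P ∈ S} =
      if P ∈ L then min 1 (ENNReal.ofReal (ρ P)) else 0 := by
  have h := sampleList_toOuterMeasure ρ {P} L hL T
  simpa only [Finset.singleton_subset_iff, Finset.prod_singleton, if_neg hP] using h

theorem sampleList_pair (ρ : List G.Edge → ℝ) {L : List (List G.Edge)} (hL : L.Nodup)
    {T : Finset (List G.Edge)} {P Q : List G.Edge} (hPQ : P ≠ Q) (hP : P ∉ T) (hQ : Q ∉ T) :
    (sampleList ρ L T).toOuterMeasure {S | P ∈ S ∧ Q ∈ S} =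
      if P ∈ L ∧ Q ∈ L then min 1 (ENNReal.ofReal (ρ P)) * min 1 (ENNReal.ofReal (ρ Q)) else 0 := by
  have h := sampleList_toOuterMeasure ρ {P, Q} L hL T
  simp only [Finset.insert_subset_iff, Finset.singleton_subset_iff, Finset.prod_pair hPQ,
    if_neg hP, if_neg hQ] at h
  rw [h]
  by_cases h1 : P ∈ L <;> by_cases h2 : Q ∈ L <;> simp [h1, h2]

theorem bind_toOuterMeasure_eq {α β : Type*} (m : PMF α) (f : α → PMF β) (A : Set β) (B : Set α)
    (c : ℝ≥0∞) (h1 : ∀ a ∈ m.support, a ∈ B → (f a).toOuterMeasure A = c)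
    (h2 : ∀ a ∈ m.support, a ∉ B → (f a).toOuterMeasure A = 0) :
    (m.bind f).toOuterMeasure A = m.toOuterMeasure B * c := by
  rw [PMF.toOuterMeasure_bind_apply, PMF.toOuterMeasure_apply, ← ENNReal.tsum_mul_right]
  refine tsum_congr fun a => ?_
  by_cases ha : a ∈ m.support
  · by_cases hB : a ∈ B
    · rw [h1 a ha hB, Set.indicator_of_mem hB]
    · rw [h2 a ha hB, Set.indicator_of_notMem hB, mul_zero, zero_mul]
  · rw [PMF.mem_support_iff, not_not] at ha
    rw [ha, zero_mul, Set.indicator_apply_eq_zero.2 fun _ => ha, zero_mul]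

theorem numPaths_eq_sum {s : V} (hs : G.level s = ℓ) (T : Finset (List G.Edge)) :
    (G.numPaths s T : ℝ) =
      ∑ P ∈ G.pathsBetween ℓ G.root s, Set.indicator {S | P ∈ S} (fun _ => (1 : ℝ)) T := by
  classical
  have h : (T.filter fun P => G.IsPath G.root P s) =
      (G.pathsBetween ℓ G.root s).filter fun P => P ∈ T := by
    ext P
    simp only [Finset.mem_filter, mem_pathsBetween]
    refine ⟨fun h => ⟨⟨?_, h.2⟩, h.1⟩, fun h => ⟨h.2, h.1.2⟩⟩
    have := h.2.level_eq
    rw [level_root, hs] at this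
    omega
  have h' : G.numPaths s T = (T.filter fun P => G.IsPath G.root P s).card := by
    unfold numPaths
    congr!
  rw [h', h, Finset.card_filter]
  push_cast
  refine Finset.sum_congr rfl fun P _ => ?_
  by_cases hP : P ∈ T <;> simp [hP]

end Phases

/-! ### First and second moment of the number of sampled paths -/

section Moments

variable {V : Type*} [Fintype V] [DecidableEq V] {ℓ : ℕ} {G : LayeredDigraph V ℓ} {t : ℕ}
  {Y : Finset G.Var → ℝ}

/-- The truncation in `coin` does nothing. -/
theorem min_one_stepProb (hY : Y ∈ G.LasLP t) {P : List G.Edge} {e : G.Edge} (hP : P.length ≤ t) :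
    min 1 (ENNReal.ofReal (stepProb Y (P ++ [e]))) = ENNReal.ofReal (stepProb Y (P ++ [e])) := by
  refine min_eq_right (ENNReal.ofReal_le_one.2 ?_)
  rw [stepProb, List.dropLast_concat]
  exact (G.pathValue_ratio_mem hY P e hP).2

theorem stepProb_nonneg (hY : Y ∈ G.LasLP t) {P : List G.Edge} {e : G.Edge} (hP : P.length ≤ t) :
    0 ≤ stepProb Y (P ++ [e]) := by
  rw [stepProb, List.dropLast_concat]
  exact (G.pathValue_ratio_mem hY P e hP).1

theorem pathValue_mul_stepProb (hY : Y ∈ G.LasLP t) {P : List G.Edge} {e : G.Edge}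
    (hP : P.length ≤ t) : G.pathValue Y P * stepProb Y (P ++ [e]) = G.pathValue Y (P ++ [e]) := by
  rw [stepProb, List.dropLast_concat]
  by_cases h : G.pathValue Y P = 0
  · -- an extension of a path of value zero has value zero as well
    have hcard : (capSet (P ++ [e])).card ≤ t + 1 :=
      (card_capSet_le _).trans (by rw [List.length_append, List.length_singleton]; omega)
    have h1 := Las_antitone hY (I := capSet P) (J := capSet (P ++ [e]))
      (by rw [capSet_append]; exact Finset.subset_union_left) hcard
    rw [← pathValue_eq Y, ← pathValue_eq Y, h] at h1
    rw [h, zero_mul, le_antisymm h1.2 h1.1]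
  · rw [mul_div_cancel₀ _ h]

/-- An upper bound on the probability that `P` and `Q` are both sampled, for paths `P` and `Q` of
the same length. The exact probability is `y_P` times the summand of the longest common prefix of
`P` and `Q`; all other common prefixes are added to it. -/
def pairBound (Y : Finset G.Var → ℝ) (P Q : List G.Edge) : ℝ :=
  G.pathValue Y P * ∑ i ∈ Finset.range (P.length + 1),
    if P.take i = Q.take i then G.pathValue Y Q / G.pathValue Y (P.take i) else 0

theorem pairBound_term_nonneg (hY : Y ∈ G.LasLP t) {P Q : List G.Edge} (hP : P.length ≤ t + 1)
    (hQ : Q.length ≤ t + 1) (i : ℕ) :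
    0 ≤ if P.take i = Q.take i then G.pathValue Y Q / G.pathValue Y (P.take i) else 0 := by
  split_ifs
  · exact div_nonneg (pathValue_nonneg hY hQ)
      (pathValue_nonneg hY ((List.length_take_le' _ _).trans hP))
  · exact le_rfl

/-- The summand of the prefix `P` itself accounts for the diagonal pair. -/
theorem pathValue_le_pairBound_self (hY : Y ∈ G.LasLP t) {P : List G.Edge}
    (hP : P.length ≤ t + 1) : G.pathValue Y P ≤ pairBound Y P P := by
  have h := Finset.single_le_sum (f := fun i => if P.take i = P.take i then
      G.pathValue Y P / G.pathValue Y (P.take i) else 0)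
    (fun i _ => pairBound_term_nonneg hY hP hP i) (Finset.self_mem_range_succ P.length)
  refine le_trans ?_ (mul_le_mul_of_nonneg_left h (pathValue_nonneg hY hP))
  rw [if_pos rfl, List.take_length, mul_div_assoc', mul_self_div_self]

/-- The pair bound is inherited by the extensions of two paths by independent coins; the one new
prefix length on the right-hand side is needed only for `P ++ [e] = Q ++ [e']`. -/
theorem pairBound_append (hY : Y ∈ G.LasLP t) {P Q : List G.Edge} {e e' : G.Edge}
    (hP : P.length ≤ t) (hPQ : P.length = Q.length) :
    pairBound Y P Q * (stepProb Y (P ++ [e]) * stepProb Y (Q ++ [e'])) ≤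
      pairBound Y (P ++ [e]) (Q ++ [e']) := by
  have hlen : ∀ (R : List G.Edge) (a : G.Edge), R.length ≤ t → (R ++ [a]).length ≤ t + 1 :=
    fun R a h => by rw [List.length_append, List.length_singleton]; omega
  have hPe := hlen P e hP
  have hQe := hlen Q e' (hPQ ▸ hP)
  rw [pairBound, pairBound, mul_mul_mul_comm, pathValue_mul_stepProb hY hP]
  refine mul_le_mul_of_nonneg_left ?_ (pathValue_nonneg hY hPe)
  rw [List.length_append, List.length_singleton, Finset.sum_range_succ _ (P.length + 1),
    Finset.sum_mul]
  refine le_add_of_le_of_nonneg (Finset.sum_le_sum fun i hi => le_of_eq ?_)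
    (pairBound_term_nonneg hY hPe hQe _)
  have hi' : i ≤ P.length := Nat.lt_succ_iff.1 (Finset.mem_range.1 hi)
  rw [List.take_append_of_le_length hi', List.take_append_of_le_length (hPQ ▸ hi')]
  split_ifs
  · rw [div_mul_eq_mul_div, pathValue_mul_stepProb hY (hPQ ▸ hP)]
  · exact zero_mul _

/-- Every path `P ++ [e]` from the root is sampled with probability equal to its value. -/
theorem phasePMF_single (hY : Y ∈ G.LasLP t) (n : ℕ) (hn : n ≤ t) {P : List G.Edge} {e : G.Edge}
    (hP : G.IsPath G.root P e.1.1) (hlen : P.length = n) :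
    (phasePMF Y n).toOuterMeasure {S | P ++ [e] ∈ S} =
      ENNReal.ofReal (G.pathValue Y (P ++ [e])) := by
  induction n generalizing P e with
  | zero =>
    obtain rfl := List.length_eq_zero_iff.1 hlen
    have he : [e] ∈ (G.outEdges G.root).toList.map fun e => [e] :=
      List.mem_map.2
        ⟨e, Finset.mem_toList.2 (Finset.mem_filter.2 ⟨Finset.mem_univ _, hP.symm⟩), rfl⟩
    rw [phasePMF, rootPhase_eq hY.2.2, List.nil_append,
      sampleList_single _ nodup_rootCandidates (Finset.notMem_empty _), if_pos he,
      ← List.nil_append [e], min_one_stepProb hY (Nat.zero_le _),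
      ← pathValue_mul_stepProb hY (Nat.zero_le _), pathValue_nil hY, one_mul]
  | succ n ih =>
    obtain rfl | ⟨P', a, rfl⟩ := List.eq_nil_or_concat' P
    · cases hlen
    obtain ⟨hP', ha⟩ := isPath_append_singleton.1 hP
    have hlen' : P'.length = n := by simpa using hlen
    rw [phasePMF, bind_toOuterMeasure_eq _ _ _ {S | P' ++ [a] ∈ S}
      (ENNReal.ofReal (stepProb Y (P' ++ [a] ++ [e]))), ih (by omega) hP' hlen',
      ← ENNReal.ofReal_mul (pathValue_nonneg hY (by omega)), pathValue_mul_stepProb hY (by omega)]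
    · intro T hT hPT
      rw [levelPhase_eq, sampleList_single _ (nodup_candidates _ _)
        (append_notMem_of_mem_support hY.2.2 hT hlen), if_pos ((mem_candidates_iff hP hlen).2 hPT),
        min_one_stepProb hY (by omega)]
    · intro T hT hPT
      rw [levelPhase_eq, sampleList_single _ (nodup_candidates _ _)
        (append_notMem_of_mem_support hY.2.2 hT hlen),
        if_neg fun h => hPT ((mem_candidates_iff hP hlen).1 h)]

theorem phasePMF_pair_self (hY : Y ∈ G.LasLP t) (n : ℕ) (hn : n ≤ t) {P : List G.Edge} {e : G.Edge}
    (hP : G.IsPath G.root P e.1.1) (hlen : P.length = n) :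
    (phasePMF Y n).toOuterMeasure {S | P ++ [e] ∈ S ∧ P ++ [e] ∈ S} ≤
      ENNReal.ofReal (pairBound Y (P ++ [e]) (P ++ [e])) := by
  simp only [and_self]
  rw [phasePMF_single hY n hn hP hlen]
  exact ENNReal.ofReal_le_ofReal (pathValue_le_pairBound_self hY
    (by rw [List.length_append, List.length_singleton]; omega))

/-- The probability that two paths are both sampled. If they differ, then their last edges are
chosen by different coins. -/
theorem phasePMF_pair (hY : Y ∈ G.LasLP t) (n : ℕ) (hn : n ≤ t) {P Q : List G.Edge} {e e' : G.Edge}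
    (hP : G.IsPath G.root P e.1.1) (hQ : G.IsPath G.root Q e'.1.1) (hlenP : P.length = n)
    (hlenQ : Q.length = n) :
    (phasePMF Y n).toOuterMeasure {S | P ++ [e] ∈ S ∧ Q ++ [e'] ∈ S} ≤
      ENNReal.ofReal (pairBound Y (P ++ [e]) (Q ++ [e'])) := by
  have hstep := pairBound_append (e := e) (e' := e') hY (hlenP.trans_le hn)
    (hlenP.trans hlenQ.symm)
  have hprob := ENNReal.ofReal_mul (stepProb_nonneg (e := e) hY (hlenP.trans_le hn))
    (q := stepProb Y (Q ++ [e']))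
  induction n generalizing P Q e e' with
  | zero =>
    by_cases hne : P ++ [e] = Q ++ [e']
    · obtain ⟨rfl, h⟩ := List.append_inj' hne rfl
      obtain rfl := List.singleton_inj.1 h
      exact phasePMF_pair_self hY _ hn hP hlenP
    refine le_trans ?_ (ENNReal.ofReal_le_ofReal hstep)
    obtain rfl := List.length_eq_zero_iff.1 hlenP
    obtain rfl := List.length_eq_zero_iff.1 hlenQ
    have h1 : pairBound Y ([] : List G.Edge) [] = 1 := by simp [pairBound, pathValue_nil hY]
    have hle := sampleList_pair (stepProb Y) nodup_rootCandidates hne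
      (Finset.notMem_empty _) (Finset.notMem_empty _)
    rw [phasePMF, rootPhase_eq hY.2.2, hle, h1, one_mul, hprob,
      min_one_stepProb hY (Nat.zero_le _), min_one_stepProb hY (Nat.zero_le _)]
    split_ifs
    · exact le_rfl
    · exact zero_le
  | succ n ih =>
    by_cases hne : P ++ [e] = Q ++ [e']
    · obtain ⟨rfl, h⟩ := List.append_inj' hne rfl
      obtain rfl := List.singleton_inj.1 h
      exact phasePMF_pair_self hY _ hn hP hlenP
    refine le_trans ?_ (ENNReal.ofReal_le_ofReal hstep)
    obtain rfl | ⟨P', a, rfl⟩ := List.eq_nil_or_concat' P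
    · cases hlenP
    obtain rfl | ⟨Q', a', rfl⟩ := List.eq_nil_or_concat' Q
    · cases hlenQ
    obtain ⟨hP', -⟩ := isPath_append_singleton.1 hP
    obtain ⟨hQ', -⟩ := isPath_append_singleton.1 hQ
    have hlenP' : P'.length = n := by simpa using hlenP
    have hlenQ' : Q'.length = n := by simpa using hlenQ
    have ih' := ih (by omega) hP' hQ' hlenP' hlenQ'
      (pairBound_append hY (by omega) (by omega))
      (ENNReal.ofReal_mul (stepProb_nonneg hY (by omega)))
    rw [phasePMF, bind_toOuterMeasure_eq _ _ _ {S | P' ++ [a] ∈ S ∧ Q' ++ [a'] ∈ S}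
      (ENNReal.ofReal (stepProb Y (P' ++ [a] ++ [e]) * stepProb Y (Q' ++ [a'] ++ [e']))),
      ENNReal.ofReal_mul' (mul_nonneg (stepProb_nonneg hY (by omega))
        (stepProb_nonneg hY (by omega)))]
    · gcongr
    · intro T hT hPQ
      rw [levelPhase_eq, sampleList_pair _ (nodup_candidates _ _) hne
        (append_notMem_of_mem_support hY.2.2 hT hlenP)
        (append_notMem_of_mem_support hY.2.2 hT hlenQ),
        if_pos ⟨(mem_candidates_iff hP hlenP).2 hPQ.1, (mem_candidates_iff hQ hlenQ).2 hPQ.2⟩,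
        min_one_stepProb hY (by omega), min_one_stepProb hY (by omega), hprob]
    · intro T hT hPQ
      rw [levelPhase_eq, sampleList_pair _ (nodup_candidates _ _) hne
        (append_notMem_of_mem_support hY.2.2 hT hlenP)
        (append_notMem_of_mem_support hY.2.2 hT hlenQ),
        if_neg fun h => hPQ
          ⟨(mem_candidates_iff hP hlenP).1 h.1, (mem_candidates_iff hQ hlenQ).1 h.2⟩]

/-- Given `P`, each of the at most `ℓ + 1` prefixes of `P` contributes at most one to the expected
number of sampled paths to `s`. -/
theorem sum_sum_pairBound_le (hℓ : 1 ≤ ℓ) (hY : Y ∈ G.LasLP t) (ht : ℓ ≤ t) (s : V)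
    (hs : G.level s = ℓ) :
    ∑ P ∈ G.pathsBetween ℓ G.root s, ∑ Q ∈ G.pathsBetween ℓ G.root s, pairBound Y P Q ≤ ℓ + 1 := by
  calc ∑ P ∈ G.pathsBetween ℓ G.root s, ∑ Q ∈ G.pathsBetween ℓ G.root s, pairBound Y P Q
      ≤ ∑ P ∈ G.pathsBetween ℓ G.root s, G.pathValue Y P * (ℓ + 1) := by
        refine Finset.sum_le_sum fun P hP => ?_
        have hlen := (mem_pathsBetween.1 hP).1
        simp only [pairBound]
        rw [← Finset.mul_sum, Finset.sum_comm]
        refine mul_le_mul_of_nonneg_left ?_ (pathValue_nonneg hY (by omega))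
        have hterm : ∀ i ∈ Finset.range (P.length + 1), (∑ Q ∈ G.pathsBetween ℓ G.root s,
            if P.take i = Q.take i then G.pathValue Y Q / G.pathValue Y (P.take i) else 0) ≤ 1 := by
          intro i hi
          have hi' : i ≤ P.length := Nat.lt_succ_iff.1 (Finset.mem_range.1 hi)
          have hlen' : (P.take i).length = i := List.length_take_of_le hi'
          rw [← Finset.sum_filter, ← Finset.sum_div]
          refine div_le_one_of_le₀ ?_ (pathValue_nonneg hY (by omega))
          simp only [eq_comm (a := P.take i)]
          exact sum_pathValue_take_le hY _ _ (by omega) (by omega) hlen'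
        refine (Finset.sum_le_card_nsmul _ _ _ hterm).trans (le_of_eq ?_)
        rw [Finset.card_range, hlen, nsmul_one]
        push_cast
        rfl
    _ = ℓ + 1 := by rw [← Finset.sum_mul, sum_pathValue_eq_one hℓ hY ht s hs, one_mul]

theorem roundingMeasure_real_single (hY : Y ∈ G.LasLP t) (ht : ℓ ≤ t) (hℓ : 1 ≤ ℓ) {s : V}
    {P : List G.Edge} (hP : P ∈ G.pathsBetween ℓ G.root s) :
    (G.roundingMeasure Y).real {S | P ∈ S} = G.pathValue Y P := by
  obtain ⟨hlen, hpath⟩ := mem_pathsBetween.1 hP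
  obtain rfl | ⟨P', a, rfl⟩ := List.eq_nil_or_concat' P
  · rw [List.length_nil] at hlen; omega
  rw [List.length_append, List.length_singleton] at hlen
  rw [Measure.real, roundingMeasure, PMF.toMeasure_apply_eq_toOuterMeasure, roundingPMF_eq,
    phasePMF_single hY _ (by omega) (isPath_append_singleton.1 hpath).1 (by omega),
    ENNReal.toReal_ofReal]
  exact pathValue_nonneg hY (by rw [List.length_append, List.length_singleton]; omega)

theorem roundingMeasure_real_pair_le (hY : Y ∈ G.LasLP t) (ht : ℓ ≤ t) (hℓ : 1 ≤ ℓ) {s : V}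
    {P Q : List G.Edge} (hP : P ∈ G.pathsBetween ℓ G.root s)
    (hQ : Q ∈ G.pathsBetween ℓ G.root s) :
    (G.roundingMeasure Y).real {S | P ∈ S ∧ Q ∈ S} ≤ pairBound Y P Q := by
  obtain ⟨hlenP, hpathP⟩ := mem_pathsBetween.1 hP
  obtain ⟨hlenQ, hpathQ⟩ := mem_pathsBetween.1 hQ
  have hnonneg : 0 ≤ pairBound Y P Q := mul_nonneg (pathValue_nonneg hY (by omega))
    (Finset.sum_nonneg fun i _ => pairBound_term_nonneg hY (by omega) (by omega) i)
  obtain rfl | ⟨P', a, rfl⟩ := List.eq_nil_or_concat' P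
  · rw [List.length_nil] at hlenP; omega
  obtain rfl | ⟨Q', a', rfl⟩ := List.eq_nil_or_concat' Q
  · rw [List.length_nil] at hlenQ; omega
  rw [List.length_append, List.length_singleton] at hlenP hlenQ
  rw [Measure.real, roundingMeasure, PMF.toMeasure_apply_eq_toOuterMeasure, roundingPMF_eq]
  exact ENNReal.toReal_le_of_le_ofReal hnonneg
    (phasePMF_pair hY _ (by omega) (isPath_append_singleton.1 hpathP).1
      (isPath_append_singleton.1 hpathQ).1 (by omega) (by omega))

end Moments

end LayeredDigraph

/-! ### The second moment method -/

/-- If `Z` vanishes off `A`, then `2 c Z - c² Z² = 1 - (1 - c Z)²` is a lower bound for the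
indicator of `A`. Its expectation for `c = 1 / C` is at least `1 / C` if `E[Z] = 1` and
`E[Z²] ≤ C`. -/
theorem inv_le_measureReal_of_integral_sq_le {Ω : Type*} [MeasurableSpace Ω] {μ : Measure Ω}
    [IsProbabilityMeasure μ] {Z : Ω → ℝ} {A : Set Ω} (hA : MeasurableSet A)
    (hZ : Integrable Z μ) (hZ2 : Integrable (fun ω => Z ω ^ 2) μ) (hZA : ∀ ω, ω ∉ A → Z ω = 0)
    (h1 : ∫ ω, Z ω ∂μ = 1) {C : ℝ} (hC : 0 < C) (h2 : ∫ ω, Z ω ^ 2 ∂μ ≤ C) :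
    1 / C ≤ μ.real A := by
  have hint : Integrable (fun ω => 2 / C * Z ω - 1 / C ^ 2 * Z ω ^ 2) μ :=
    (hZ.const_mul _).sub (hZ2.const_mul _)
  have h := integral_mono hint ((integrable_const (1 : ℝ)).indicator hA) fun ω => by
    by_cases hω : ω ∈ A
    · simp only [Set.indicator_of_mem hω]
      have := sq_nonneg (1 - Z ω / C)
      have h3 : (1 - Z ω / C) ^ 2 = 1 - (2 / C * Z ω - 1 / C ^ 2 * Z ω ^ 2) := by ring
      linarith
    · simp [Set.indicator_of_notMem hω, hZA ω hω]
  rw [integral_sub (hZ.const_mul _) (hZ2.const_mul _), integral_const_mul, integral_const_mul, h1,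
    integral_indicator_const _ hA, smul_eq_mul, mul_one, mul_one] at h
  have h3 : 1 / C ^ 2 * ∫ ω, Z ω ^ 2 ∂μ ≤ 1 / C ^ 2 * C := by gcongr
  have h4 : 1 / C ^ 2 * C = 1 / C := by field_simp
  have h5 : 2 / C = 1 / C + 1 / C := by ring
  linarith

theorem mainTheorem2 {V : Type*} [Fintype V] [DecidableEq V] {ℓ : ℕ} (hℓ : 1 ≤ ℓ)
    (G : LayeredDigraph V ℓ) (Y : Finset G.Var → ℝ) (hY : Y ∈ G.LasLP (2 * ℓ))
    (s : V) (hs : G.level s = ℓ) :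
    -- the expectation of `Z` exists and equals one
    MeasureTheory.Integrable (fun T => (G.numPaths s T : ℝ)) (G.roundingMeasure Y) ∧
    ∫ T, (G.numPaths s T : ℝ) ∂(G.roundingMeasure Y) = 1 ∧
    -- the conditional expectation of `Z` given `Z ≥ 1` exists and is at most `ℓ + 1`
    G.roundingMeasure Y {T | 1 ≤ G.numPaths s T} ≠ 0 ∧
    MeasureTheory.Integrable (fun T => (G.numPaths s T : ℝ))
      (ProbabilityTheory.cond (G.roundingMeasure Y) {T | 1 ≤ G.numPaths s T}) ∧
    ∫ T, (G.numPaths s T : ℝ)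
        ∂(ProbabilityTheory.cond (G.roundingMeasure Y) {T | 1 ≤ G.numPaths s T}) ≤ (ℓ : ℝ) + 1 ∧
    -- hence `s` is connected with probability at least `1 / (ℓ + 1)`
    1 / ((ℓ : ℝ) + 1) ≤ (G.roundingMeasure Y).real {T | 1 ≤ G.numPaths s T} ∧
    1 / ((ℓ : ℝ) + 1) ≤ (G.roundingMeasure Y).real {T | G.Connects s T} := by
  classical
  have ht : ℓ ≤ 2 * ℓ := by omega
  have : IsProbabilityMeasure (G.roundingMeasure Y) := PMF.toMeasure.isProbabilityMeasure _
  set μ := G.roundingMeasure Y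
  set A : Set (Finset (List G.Edge)) := {T | 1 ≤ G.numPaths s T}
  have hmeas : ∀ B : Set (Finset (List G.Edge)), MeasurableSet B := fun B =>
    MeasurableSet.of_discrete
  have hA := hmeas A
  have hind : ∀ B : Set (Finset (List G.Edge)), Integrable (B.indicator fun _ => (1 : ℝ)) μ :=
    fun B => (integrable_const (1 : ℝ)).indicator (hmeas B)
  have hsq : ∀ T, (G.numPaths s T : ℝ) ^ 2 = ∑ P ∈ G.pathsBetween ℓ G.root s,
      ∑ Q ∈ G.pathsBetween ℓ G.root s,
        Set.indicator {S | P ∈ S ∧ Q ∈ S} (fun _ => (1 : ℝ)) T := by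
    intro T
    rw [LayeredDigraph.numPaths_eq_sum hs, sq, Finset.sum_mul_sum]
    refine Finset.sum_congr rfl fun P _ => Finset.sum_congr rfl fun Q _ => ?_
    by_cases hP : P ∈ T <;> by_cases hQ : Q ∈ T <;> simp [hP, hQ]
  have hint : Integrable (fun T => (G.numPaths s T : ℝ)) μ := by
    simp only [LayeredDigraph.numPaths_eq_sum hs]
    exact integrable_finsetSum _ fun P _ => hind _
  have hint2 : Integrable (fun T => (G.numPaths s T : ℝ) ^ 2) μ := by
    simp only [hsq]
    exact integrable_finsetSum _ fun P _ => integrable_finsetSum _ fun Q _ => hind _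
  have hone : ∫ T, (G.numPaths s T : ℝ) ∂μ = 1 := by
    simp only [LayeredDigraph.numPaths_eq_sum hs]
    rw [integral_finsetSum _ fun P _ => hind _]
    refine (Finset.sum_congr rfl fun P hP => ?_).trans
      (LayeredDigraph.sum_pathValue_eq_one hℓ hY ht s hs)
    rw [integral_indicator_const _ (hmeas _), smul_eq_mul, mul_one,
      LayeredDigraph.roundingMeasure_real_single hY ht hℓ hP]
  have htwo : ∫ T, (G.numPaths s T : ℝ) ^ 2 ∂μ ≤ ℓ + 1 := by
    simp only [hsq]
    rw [integral_finsetSum _ fun P _ => integrable_finsetSum _ fun Q _ => hind _]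
    refine le_trans (Finset.sum_le_sum fun P hP => ?_)
      (LayeredDigraph.sum_sum_pairBound_le hℓ hY ht s hs)
    rw [integral_finsetSum _ fun Q _ => hind _]
    refine Finset.sum_le_sum fun Q hQ => ?_
    rw [integral_indicator_const _ (hmeas _), smul_eq_mul, mul_one]
    exact LayeredDigraph.roundingMeasure_real_pair_le hY ht hℓ hP hQ
  have hzero : ∀ T, T ∉ A → (G.numPaths s T : ℝ) = 0 := fun T hT => by
    simpa [A] using hT
  have hpos : (0 : ℝ) < ℓ + 1 := by positivity
  have hprob : 1 / ((ℓ : ℝ) + 1) ≤ μ.real A :=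
    inv_le_measureReal_of_integral_sq_le hA hint hint2 hzero hone hpos htwo
  have hAreal : 0 < μ.real A := lt_of_lt_of_le (by positivity) hprob
  have hA0 : μ A ≠ 0 := fun h => by simp [Measure.real, h] at hAreal
  refine ⟨hint, hone, hA0, ?_, ?_, hprob, hprob.trans ?_⟩
  · exact (hint.mono_measure Measure.restrict_le_self).smul_measure (ENNReal.inv_ne_top.2 hA0)
  · -- `Z` vanishes off `A`, so `E[Z | A] = E[Z] / Pr[A] = 1 / Pr[A]`
    rw [ProbabilityTheory.cond, integral_smul_measure,
      setIntegral_eq_integral_of_forall_compl_eq_zero hzero, hone, smul_eq_mul, mul_one,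
      ENNReal.toReal_inv]
    exact inv_le_of_inv_le₀ hpos (by rwa [← one_div])
  · refine measureReal_mono fun T hT => ?_
    obtain ⟨P, hP⟩ := Finset.card_pos.1 (Nat.lt_of_succ_le hT)
    obtain ⟨hPT, hpath⟩ := Finset.mem_filter.1 hP
    exact ⟨P, hpath, fun e he => ⟨P, hPT, he⟩⟩
end
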